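/- Let $\mathbb{K}$ be a field. A Leibniz algebra over $\mathbb{K}$ is a $\mathbb{K}$-vector space with a bilinear bracket satisfying $[x,[y,z]]=[[x,y],z]-[[x,z],y]$; every Lie algebra is a Leibniz algebra with the same bracket. The center of a Leibniz algebra $\mathfrak{q}$ is the two-sided ideal $Z(\mathfrak{q})=\{c\in\mathfrak{q} : [x,c]=0=[c,x]\ \text{for all}\ x\in\mathfrak{q}\}$. A Lie algebra $L$ over $\mathbb{K}$ is called capable in the category of Lie (respectively, Leibniz) algebras if there is a Lie (respectively, Leibniz) algebra $Q$ over $\mathbb{K}$ with $L\cong Q/Z(Q)$ as Lie (respectively, Leibniz) algebras, and $L$ is called perfect if $L=[L,L]$, where $[L,L]$ is the linear span of all brackets. Let $L$ be a perfect Lie algebra over $\mathbb{K}$ (of arbitrary dimension). Then $L$ is capable in the category of Lie algebras if and only if $L$ is capable in the category of Leibniz algebras, and each of these two conditions is equivalent to $Z(L)=0$. -/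

import Mathlib

universe u v

/-- A (right) Leibniz algebra over a field `K`: a vector space `g` with a bilinear bracket such that
`[x,[y,z]] = [[x,y],z] - [[x,z],y]`. -/
class LeibnizAlgebra (K : Type u) (g : Type v) [Field K] [AddCommGroup g] [Module K g] where
  /-- The Leibniz bracket `[x, y] = bracket x y`. -/
  bracket : g →ₗ[K] g →ₗ[K] g
  /-- The Leibniz identity. -/
  leibniz : ∀ x y z : g,
    bracket x (bracket y z) = bracket (bracket x y) z - bracket (bracket x z) y

/-- A two-sided ideal of a Leibniz algebra. -/
structure LeibnizIdeal (K : Type u) (g : Type v) [Field K] [AddCommGroup g] [Module K g]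
    [LeibnizAlgebra K g] extends Submodule K g where
  bracket_mem_left : ∀ a ∈ carrier, ∀ x : g, LeibnizAlgebra.bracket (K := K) a x ∈ carrier
  bracket_mem_right : ∀ a ∈ carrier, ∀ x : g, LeibnizAlgebra.bracket (K := K) x a ∈ carrier

/-- An isomorphism of Leibniz algebras: a linear isomorphism which preserves the bracket. -/
structure LeibnizEquiv (K : Type u) (g h : Type*) [Field K]
    [AddCommGroup g] [Module K g] [LeibnizAlgebra K g]
    [AddCommGroup h] [Module K h] [LeibnizAlgebra K h] extends g ≃ₗ[K] h where
  map_bracket : ∀ x y : g, toFun (LeibnizAlgebra.bracket (K := K) x y) =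
    LeibnizAlgebra.bracket (K := K) (toFun x) (toFun y)

namespace LeibnizAlgebra

/-- The bracket `[x + I, y + I] = [x, y] + I` on the quotient of a Leibniz algebra by an ideal. -/
def quotientBracket {K : Type u} {g : Type v} [Field K] [AddCommGroup g] [Module K g]
    [LeibnizAlgebra K g] (I : LeibnizIdeal K g) :
    (g ⧸ I.toSubmodule) →ₗ[K] (g ⧸ I.toSubmodule) →ₗ[K] (g ⧸ I.toSubmodule) :=
  I.toSubmodule.liftQ
    (LinearMap.flip (I.toSubmodule.liftQ
      (LinearMap.flip ((bracket (K := K) (g := g)).compr₂ I.toSubmodule.mkQ))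
      (fun a ha => by
        ext x
        exact (Submodule.Quotient.mk_eq_zero _).2 (I.bracket_mem_right a ha x))))
    (fun a ha => by
      ext x
      exact (Submodule.Quotient.mk_eq_zero _).2 (I.bracket_mem_left a ha x))

theorem quotientBracket_mk {K : Type u} {g : Type v} [Field K] [AddCommGroup g] [Module K g]
    [LeibnizAlgebra K g] (I : LeibnizIdeal K g) (x y : g) :
    quotientBracket I (Submodule.Quotient.mk x) (Submodule.Quotient.mk y) =
      Submodule.Quotient.mk (bracket (K := K) x y) := rfl

/-- The quotient of a Leibniz algebra by a two-sided ideal is a Leibniz algebra. -/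
instance quotient {K : Type u} {g : Type v} [Field K] [AddCommGroup g] [Module K g]
    [LeibnizAlgebra K g] (I : LeibnizIdeal K g) : LeibnizAlgebra K (g ⧸ I.toSubmodule) where
  bracket := quotientBracket I
  leibniz x y z := by
    induction x using Submodule.Quotient.induction_on with | _ x
    induction y using Submodule.Quotient.induction_on with | _ y
    induction z using Submodule.Quotient.induction_on with | _ z
    simp only [quotientBracket_mk, leibniz x y z, Submodule.Quotient.mk_sub]

/-- The center `Z(g) = {c | [x, c] = 0 = [c, x] for all x}`, as a two-sided ideal. -/
def center (K : Type u) (g : Type v) [Field K] [AddCommGroup g] [Module K g]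
    [LeibnizAlgebra K g] : LeibnizIdeal K g where
  carrier := {c | ∀ x : g, bracket (K := K) x c = 0 ∧ bracket (K := K) c x = 0}
  zero_mem' := fun x => by simp
  add_mem' := fun {a b} ha hb x => by simp [(ha x).1, (ha x).2, (hb x).1, (hb x).2]
  smul_mem' := fun t a ha x => by simp [(ha x).1, (ha x).2]
  bracket_mem_left := fun a ha x y => by simp [(ha x).2]
  bracket_mem_right := fun a ha x y => by simp [(ha x).1]

/-- A Lie algebra is a Leibniz algebra with the same bracket. -/
instance ofLieAlgebra (K : Type u) (L : Type v) [Field K] [LieRing L] [LieAlgebra K L] :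
    LeibnizAlgebra K L where
  bracket := LinearMap.mk₂ K (fun x y : L => ⁅x, y⁆) add_lie smul_lie lie_add lie_smul
  leibniz x y z := by
    simp only [LinearMap.mk₂_apply]
    rw [leibniz_lie x y z, ← lie_skew y ⁅x, z⁆, sub_eq_add_neg]

/-- A Leibniz algebra `g` is capable if `g ≅ q / Z(q)` for some Leibniz algebra `q`. -/
def IsCapable (K : Type u) (g : Type v) [Field K] [AddCommGroup g] [Module K g]
    [LeibnizAlgebra K g] : Prop :=
  ∃ (q : Type v) (_ : AddCommGroup q) (_ : Module K q) (_ : LeibnizAlgebra K q),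
    Nonempty (LeibnizEquiv K g (q ⧸ (center K q).toSubmodule))

end LeibnizAlgebra

/-- A Lie algebra `L` is capable (in the category of Lie algebras) if `L ≅ Q / Z(Q)` for some
Lie algebra `Q`. -/
def LieAlgebra.IsCapable (K : Type u) (L : Type v) [Field K] [LieRing L] [LieAlgebra K L] : Prop :=
  ∃ (Q : Type v) (_ : LieRing Q) (_ : LieAlgebra K Q),
    Nonempty (L ≃ₗ⁅K⁆ (Q ⧸ LieAlgebra.center K Q))

/-- A Lie algebra is perfect if `L = [L, L]`. -/
def LieAlgebra.IsPerfect (K : Type u) (L : Type v) [Field K] [LieRing L] [LieAlgebra K L] : Prop :=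
  ⁅(⊤ : LieIdeal K L), (⊤ : LieIdeal K L)⁆ = ⊤

namespace LieAlgebra

variable {K : Type u} {L : Type v} [Field K] [LieRing L] [LieAlgebra K L]

/-! If the center is zero, `L` is its own quotient by its center in both categories. Conversely, let
`f : q → L` be a surjection of Leibniz algebras with kernel `Z(q)`. Perfectness of `L` gives `q =
[q,q] + Z(q)`. If `f c` is central, all `[x,c]` and `[c,x]` lie in `Z(q)`, so the Leibniz identity
makes `[c,-]` and `[-,c]` vanish on `[q,q]`. They also vanish on `Z(q)`, hence `c ∈ Z(q)` and `f c =
0`. This is `lieCenter_eq_bot_of_ker_eq_center`; it covers the Lie case too, the two notions of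
center agreeing on Lie algebras. -/

theorem mem_center_iff' (c : L) : c ∈ center K L ↔ ∀ x : L, ⁅x, c⁆ = 0 :=
  LieModule.mem_maxTrivSubmodule K L L c

theorem IsPerfect.eq_top_of_lie_mem (hL : IsPerfect K L) (A : Submodule K L)
    (hA : ∀ x y : L, ⁅x, y⁆ ∈ A) : A = ⊤ := by
  have h := congrArg (fun I : LieIdeal K L => I.toSubmodule) hL
  simp only [LieSubmodule.lieIdeal_oper_eq_linear_span', LieSubmodule.top_toSubmodule] at h
  rw [← top_le_iff, ← h, Submodule.span_le]
  rintro _ ⟨x, -, y, -, rfl⟩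
  exact hA x y

/-- A Lie algebra with trivial center is the quotient of itself by its center. -/
theorem isCapable_of_center_eq_bot (h : center K L = ⊥) : IsCapable K L := by
  refine ⟨L, inferInstance, inferInstance, ⟨{
    __ := (Submodule.quotEquivOfEqBot (center K L).toSubmodule ?_).symm
    map_lie' := fun {_ _} => rfl }⟩⟩
  rw [h, LieSubmodule.bot_toSubmodule]

end LieAlgebra

namespace LeibnizAlgebra

variable {K : Type u} {L : Type v} [Field K] [LieRing L] [LieAlgebra K L]

theorem bracket_eq_lie (x y : L) : bracket (K := K) x y = ⁅x, y⁆ := rfl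

theorem mem_center_iff {q : Type*} [AddCommGroup q] [Module K q] [LeibnizAlgebra K q] (c : q) :
    c ∈ (center K q).toSubmodule ↔
      ∀ x : q, bracket (K := K) x c = 0 ∧ bracket (K := K) c x = 0 :=
  Iff.rfl

/-- For a Lie algebra the Leibniz center is the Lie center. -/
theorem center_toSubmodule_eq : (center K L).toSubmodule = (LieAlgebra.center K L).toSubmodule := by
  ext c
  rw [mem_center_iff, LieSubmodule.mem_toSubmodule, LieAlgebra.mem_center_iff']
  refine forall_congr' fun x => ⟨fun h => h.1, fun h => ⟨h, ?_⟩⟩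
  rw [bracket_eq_lie, ← lie_skew, h, neg_zero]

/-- A Lie algebra with trivial center is the quotient of itself by its Leibniz center. -/
theorem isCapable_of_center_eq_bot (h : LieAlgebra.center K L = ⊥) : IsCapable K L := by
  refine ⟨L, inferInstance, inferInstance, inferInstance, ⟨{
    __ := (Submodule.quotEquivOfEqBot (center K L).toSubmodule ?_).symm
    map_bracket := fun x y => rfl }⟩⟩
  rw [center_toSubmodule_eq, h, LieSubmodule.bot_toSubmodule]

/-- A perfect Lie algebra that is a quotient of a Leibniz algebra by its center has trivial
center. -/
theorem lieCenter_eq_bot_of_ker_eq_center (hL : LieAlgebra.IsPerfect K L)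
    {q : Type*} [AddCommGroup q] [Module K q] [LeibnizAlgebra K q] (f : q →ₗ[K] L)
    (hf : Function.Surjective f) (hker : LinearMap.ker f = (center K q).toSubmodule)
    (hlie : ∀ x y : q, f (bracket (K := K) x y) = ⁅f x, f y⁆) :
    LieAlgebra.center K L = ⊥ := by
  have hz : ∀ c : q, f c = 0 → ∀ x, bracket (K := K) x c = 0 ∧ bracket (K := K) c x = 0 := by
    intro c hc
    rwa [← mem_center_iff, ← hker, LinearMap.mem_ker]
  -- A linear map on `q` vanishing on brackets and on the center is zero.
  have hvanish : ∀ g : q →ₗ[K] q, (∀ x y, g (bracket (K := K) x y) = 0) →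
      (∀ z, f z = 0 → g z = 0) → ∀ x, g x = 0 := by
    intro g hb hc x
    -- Equivalently, `ker g + ker f` is all of `q`; this is where perfectness enters.
    have htop : (LinearMap.ker g).map f = ⊤ := by
      refine hL.eq_top_of_lie_mem _ fun a b => ?_
      obtain ⟨a, rfl⟩ := hf a
      obtain ⟨b, rfl⟩ := hf b
      exact ⟨bracket (K := K) a b, hb a b, hlie a b⟩
    obtain ⟨y, hy, hyx⟩ := htop.ge (Submodule.mem_top (x := f x))
    have := hc (x - y) (by rw [map_sub, hyx, sub_self])
    rwa [map_sub, LinearMap.mem_ker.1 hy, sub_zero] at this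
  rw [eq_bot_iff]
  intro c hc
  rw [LieAlgebra.mem_center_iff'] at hc
  obtain ⟨c, rfl⟩ := hf c
  have hr : ∀ x, f (bracket (K := K) x c) = 0 := fun x => by rw [hlie, hc]
  have hl : ∀ x, f (bracket (K := K) c x) = 0 := fun x => by
    rw [hlie, ← lie_skew, hc, neg_zero]
  have hcl : ∀ x, bracket (K := K) c x = 0 := by
    refine hvanish (bracket (K := K) c) (fun x y => ?_) fun z h => (hz z h c).1
    -- `[c,[x,y]] = [[c,x],y] - [[c,y],x]`, and both inner brackets are central.
    rw [leibniz, (hz _ (hl x) y).2, (hz _ (hl y) x).2, sub_zero]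
  have hcr : ∀ x, bracket (K := K) x c = 0 := by
    refine hvanish ((bracket (K := K)).flip c) (fun x y => ?_) fun z h => (hz z h c).2
    -- With `c` in the last slot, the identity is solved for `[[x,y],c]`; the other two terms
    -- vanish.
    have := leibniz (K := K) x y c
    rwa [(hz _ (hr y) x).1, (hz _ (hr x) y).2, sub_zero, eq_comm] at this
  have : c ∈ LinearMap.ker f := by
    rw [hker, mem_center_iff]
    exact fun x => ⟨hcr x, hcl x⟩
  rwa [LieSubmodule.mem_bot]

theorem IsCapable.lieCenter_eq_bot (hL : LieAlgebra.IsPerfect K L) (h : IsCapable K L) :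
    LieAlgebra.center K L = ⊥ := by
  obtain ⟨q, _, _, _, ⟨e⟩⟩ := h
  refine lieCenter_eq_bot_of_ker_eq_center hL
    (e.symm.toLinearMap ∘ₗ (center K q).toSubmodule.mkQ)
    (e.symm.surjective.comp (Submodule.mkQ_surjective _)) ?_ fun x y => ?_
  · rw [LinearEquiv.ker_comp, Submodule.ker_mkQ]
  -- Bracket preservation is given for `e`, not its inverse, so the equation is compared after
  -- applying `e`.
  · apply e.toLinearEquiv.injective
    refine (e.apply_symm_apply _).trans (Eq.trans ?_ (e.map_bracket _ _).symm)
    change _ = bracket (K := K) (e.toLinearEquiv (e.symm _)) (e.toLinearEquiv (e.symm _))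
    rw [e.apply_symm_apply, e.apply_symm_apply]
    rfl

end LeibnizAlgebra

/-- The Lie algebra `Q` is viewed as a Leibniz algebra, whose Leibniz center is still the kernel of
`Q → L`. -/
theorem LieAlgebra.IsCapable.center_eq_bot {K : Type u} {L : Type v} [Field K] [LieRing L]
    [LieAlgebra K L] (hL : LieAlgebra.IsPerfect K L) (h : LieAlgebra.IsCapable K L) :
    LieAlgebra.center K L = ⊥ := by
  obtain ⟨Q, _, _, ⟨e⟩⟩ := h
  refine LeibnizAlgebra.lieCenter_eq_bot_of_ker_eq_center hL
    (e.symm.toLinearEquiv.toLinearMap ∘ₗ (LieAlgebra.center K Q).toSubmodule.mkQ)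
    (e.symm.surjective.comp (Submodule.mkQ_surjective _)) ?_ fun x y => ?_
  · rw [LinearEquiv.ker_comp, Submodule.ker_mkQ, LeibnizAlgebra.center_toSubmodule_eq]
  · exact e.symm.map_lie (LieSubmodule.Quotient.mk x) (LieSubmodule.Quotient.mk y)

theorem corollary5p3 (K : Type u) (L : Type v) [Field K] [LieRing L] [LieAlgebra K L]
    (hL : LieAlgebra.IsPerfect K L) :
    (LieAlgebra.IsCapable K L ↔ LeibnizAlgebra.IsCapable K L) ∧
      (LieAlgebra.IsCapable K L ↔ LieAlgebra.center K L = ⊥) ∧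
      (LeibnizAlgebra.IsCapable K L ↔ LieAlgebra.center K L = ⊥) := by
  have hLie : LieAlgebra.IsCapable K L ↔ LieAlgebra.center K L = ⊥ :=
    ⟨fun h => h.center_eq_bot hL, LieAlgebra.isCapable_of_center_eq_bot⟩
  have hLeib : LeibnizAlgebra.IsCapable K L ↔ LieAlgebra.center K L = ⊥ :=
    ⟨fun h => h.lieCenter_eq_bot hL, LeibnizAlgebra.isCapable_of_center_eq_bot⟩
  exact ⟨hLie.trans hLeib.symm, hLie, hLeib⟩
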